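/- A p-algebra is a bounded distributive lattice with a unary operation $*$ such that $x\le y^*$ iff $x\wedge y=0$. A quasivariety of p-algebras is a class of p-algebras axiomatized by quasi-identities; $\mathbf Q(\mathbf A)$ denotes the quasivariety generated by $\mathbf A$, and $\mathsf{Pa}_m=\mathbf{HSP}(\bar{\mathbf B}_m)$, where $\bar{\mathbf B}_m$ is the Boolean algebra with $m$ atoms with a new top element added. A quasivariety $\mathsf K$ is a cover of $\mathsf{Pa}_m$ if $\mathsf{Pa}_m\subsetneq\mathsf K$ and no quasivariety of p-algebras lies strictly between them. For a poset $P$, $\varepsilon(P)$ is the p-algebra of all upsets of $P$ ordered by inclusion. For $x\in P$ let $M(x)$ be the set of maximal elements of $P$ above $x$; a map $h:P\to Q$ of posets is a pp-morphism if it is order-preserving and $M(h(x))=h[M(x)]$ for all $x\in P$. For a set $M$ and a family $\mathcal F$ of non-empty subsets of $M$, $P(M,\mathcal F)$ is the set $\{M\}\cup\{\{x\}:x\in M\}\cup\mathcal F$ ordered by reverse inclusion. **Theorem.** Let $m\ge 2$, let $|M|=m+1$, let $a,b\in M$ be distinct, and put $\mathcal E=\{\{a,b\},\,M\setminus\{a\},\,M\setminus\{b\}\}$.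 1. If $\mathcal F\subsetneq\mathcal E$, then $\mathbf Q(\varepsilon(P(M,\mathcal F)))$ is not a cover of $\mathsf{Pa}_m$. 2. For all $\mathcal F,\mathcal G\subseteq\mathcal E$, there is a surjective pp-morphism from a disjoint union of finitely many copies of $P(M,\mathcal F)$ onto $P(M,\mathcal G)$ if and only if there is a permutation $\sigma$ of $\mathcal E$ with $|\sigma(X)|=|X|$ for all $X\in\mathcal E$ and $\sigma[\mathcal F]\subseteq\mathcal G$. -/

import Mathlib

universe u v

/-! ### p-algebras -/

/-- A p-algebra: a bounded distributive lattice with a pseudocomplement `x ↦ x*`,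
i.e. `x ≤ y*` iff `x ⊓ y = ⊥`. -/
class PAlgebra (A : Type u) extends DistribLattice A, BoundedOrder A where
  star : A → A
  le_star_iff : ∀ x y : A, x ≤ star y ↔ x ⊓ y = ⊥

/-- Homomorphisms of p-algebras. -/
structure IsPAlgebraHom {A : Type u} {B : Type v} [PAlgebra A] [PAlgebra B] (f : A → B) :
    Prop where
  map_bot : f ⊥ = ⊥
  map_top : f ⊤ = ⊤
  map_inf : ∀ x y, f (x ⊓ y) = f x ⊓ f y
  map_sup : ∀ x y, f (x ⊔ y) = f x ⊔ f y
  map_star : ∀ x, f (PAlgebra.star x) = PAlgebra.star (f x)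

/-- Direct powers (with componentwise operations). -/
instance PAlgebra.power (I : Type u) (B : Type v) [PAlgebra B] : PAlgebra (I → B) where
  star x := fun i => PAlgebra.star (x i)
  le_star_iff x y := by
    simp only [Pi.le_def, PAlgebra.le_star_iff, funext_iff, Pi.inf_apply, Pi.bot_apply]

/-- A bundled p-algebra; classes of p-algebras are sets of these. -/
structure PAlg where
  carrier : Type u
  [str : PAlgebra carrier]

attribute [instance] PAlg.str

/-! ### Quasi-identities and quasivarieties -/

/-- Terms in the language of p-algebras over the variables `x₀, x₁, x₂, …`. -/
inductive PTerm where
  | var : ℕ → PTerm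
  | bot : PTerm
  | top : PTerm
  | inf : PTerm → PTerm → PTerm
  | sup : PTerm → PTerm → PTerm
  | star : PTerm → PTerm

/-- The value of a term under an assignment of the variables. -/
def PTerm.eval {A : Type u} [PAlgebra A] (v : ℕ → A) : PTerm → A
  | .var n => v n
  | .bot => ⊥
  | .top => ⊤
  | .inf s t => s.eval v ⊓ t.eval v
  | .sup s t => s.eval v ⊔ t.eval v
  | .star t => PAlgebra.star (t.eval v)

/-- A quasi-identity `s₁ = t₁ ∧ ⋯ ∧ sₙ = tₙ → s = t` (with `n ≥ 0`). -/
structure QuasiIdentity where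
  premises : List (PTerm × PTerm)
  lhs : PTerm
  rhs : PTerm

/-- Validity of a quasi-identity in a p-algebra (universally quantified over assignments). -/
def QuasiIdentity.HoldsIn (q : QuasiIdentity) (A : Type u) [PAlgebra A] : Prop :=
  ∀ v : ℕ → A, (∀ e ∈ q.premises, e.1.eval v = e.2.eval v) → q.lhs.eval v = q.rhs.eval v

/-- A quasivariety of p-algebras: the class of all p-algebras satisfying some set of
quasi-identities. -/
def IsQuasivariety (K : Set PAlg.{u}) : Prop :=
  ∃ S : Set QuasiIdentity, K = {A | ∀ q ∈ S, q.HoldsIn A.carrier}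

/-- `Q(A)`, the quasivariety generated by the p-algebra `A`: the class of all p-algebras that
satisfy every quasi-identity valid in `A`. -/
def quasivarietyOf (A : PAlg.{u}) : Set PAlg.{u} :=
  {B | ∀ q : QuasiIdentity, q.HoldsIn A.carrier → q.HoldsIn B.carrier}

/-- `K` covers `V` in the lattice of quasivarieties of p-algebras (for quasivarieties `V`, `K`):
`V` is properly contained in `K` and there is no quasivariety strictly between them. -/
def IsQuasivarietyCover (V K : Set PAlg.{u}) : Prop :=
  V ⊂ K ∧ ∀ L : Set PAlg.{u}, IsQuasivariety L → V ⊆ L → L ⊆ K → L = V ∨ L = K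

/-! ### The varieties `Pa_m` -/

/-- `B̄_k`: the Boolean algebra with `k` atoms, with a new top element added above its top. -/
def BBar (k : ℕ) : Type := WithTop (Set (Fin k))

open Classical in
/-- The pseudocomplement of `B̄_k`: the new top goes to `⊥`, the bottom to the new top, and any
other element to its Boolean complement. -/
noncomputable def BBar.starAux (k : ℕ) : WithTop (Set (Fin k)) → WithTop (Set (Fin k))
  | none => ⊥
  | some x => if x = ∅ then ⊤ else ((xᶜ : Set (Fin k)) : WithTop (Set (Fin k)))

noncomputable instance (k : ℕ) : PAlgebra (BBar k) where
  toDistribLattice := inferInstanceAs (DistribLattice (WithTop (Set (Fin k))))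
  toBoundedOrder := inferInstanceAs (BoundedOrder (WithTop (Set (Fin k))))
  star := BBar.starAux k
  le_star_iff x y := by
    have key : ∀ x y : WithTop (Set (Fin k)), x ≤ BBar.starAux k y ↔ x ⊓ y = ⊥ := by
      intro x y
      have hbot : (⊥ : WithTop (Set (Fin k))) = ((∅ : Set (Fin k)) : WithTop (Set (Fin k))) := rfl
      induction y using WithTop.recTopCoe with
      | top =>
        change x ≤ ⊥ ↔ _
        simp
      | coe y =>
        change x ≤ (if y = ∅ then ⊤ else ((yᶜ : Set (Fin k)) : WithTop (Set (Fin k)))) ↔ _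
        by_cases hy : y = ∅
        · subst hy
          rw [← hbot]
          simp
        · rw [if_neg hy]
          induction x using WithTop.recTopCoe with
          | top => simp [hbot, hy]
          | coe x =>
            rw [← WithTop.coe_inf, hbot, WithTop.coe_le_coe, WithTop.coe_inj]
            exact Set.subset_compl_iff_disjoint_right.trans Set.disjoint_iff_inter_eq_empty
    exact key x y

/-- The class `HSP(B)` of all homomorphic images of algebras embeddable into a power of `B`. -/
def HSP (B : Type) [PAlgebra B] : Set PAlg.{u} :=
  {A | ∃ (I : Type u) (C : PAlg.{u}) (i : C.carrier → (I → B)) (f : C.carrier → A.carrier),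
    IsPAlgebraHom i ∧ Function.Injective i ∧ IsPAlgebraHom f ∧ Function.Surjective f}

/-- The variety `Pa_m = HSP(B̄_m)`. -/
def Pa (m : ℕ) : Set PAlg.{u} := HSP (BBar m)

/-! ### Posets and their dual p-algebras -/

/-- The upsets of a poset, ordered by inclusion. -/
def Upset (P : Type u) [PartialOrder P] : Type u := {U : Set P // IsUpperSet U}

/-- The p-algebra of upsets: meet and join are intersection and union, and `U*` is the largest
upset disjoint from `U`. -/
instance (P : Type u) [PartialOrder P] : PAlgebra (Upset P) where
  le U V := U.1 ⊆ V.1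
  le_refl _ := subset_rfl
  le_trans _ _ _ := Set.Subset.trans
  le_antisymm _ _ h h' := Subtype.ext (Set.Subset.antisymm h h')
  inf U V := ⟨U.1 ∩ V.1, U.2.inter V.2⟩
  sup U V := ⟨U.1 ∪ V.1, U.2.union V.2⟩
  inf_le_left _ _ := Set.inter_subset_left
  inf_le_right _ _ := Set.inter_subset_right
  le_inf _ _ _ := Set.subset_inter
  le_sup_left _ _ := Set.subset_union_left
  le_sup_right _ _ := Set.subset_union_right
  sup_le _ _ _ := Set.union_subset
  le_sup_inf U V W := (Set.union_inter_distrib_left U.1 V.1 W.1).ge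
  bot := ⟨∅, isUpperSet_empty⟩
  top := ⟨Set.univ, isUpperSet_univ⟩
  bot_le U := Set.empty_subset U.1
  le_top U := Set.subset_univ U.1
  star U := ⟨{x | ∀ y, x ≤ y → y ∉ U.1}, fun _ _ hxy hx z hz => hx z (hxy.trans hz)⟩
  le_star_iff U V := by
    constructor
    · intro h
      exact Subtype.ext (Set.eq_empty_of_forall_notMem fun x hx => h hx.1 x le_rfl hx.2)
    · intro h x hx y hxy hy
      have : y ∈ (∅ : Set P) := (congrArg Subtype.val h).subset ⟨U.2 hxy hx, hy⟩
      exact this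

/-- `ε(P)`, the p-algebra dual to the poset `P`. -/
def dualAlg (P : Type u) [PartialOrder P] : PAlg.{u} := ⟨Upset P⟩

/-- `M(x)`: the set of maximal elements above `x`. -/
def maxAbove {P : Type u} [PartialOrder P] (x : P) : Set P := {y | x ≤ y ∧ IsMax y}

/-- pp-morphisms: order-preserving maps `h` with `M(h(x)) = h[M(x)]` for all `x`. -/
structure IsPPMorphism {P : Type u} {Q : Type v} [PartialOrder P] [PartialOrder Q] (h : P → Q) :
    Prop where
  monotone : Monotone h
  map_maxAbove : ∀ x, maxAbove (h x) = h '' maxAbove x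

/-- The reduced poset `P(M, F)`: its elements are the set `M`, the singletons `{m}` with `m ∈ M`,
and the members of the family `F`. -/
def ReducedPoset {M : Type u} (F : Set (Set M)) : Type u :=
  {A : Set M // A = Set.univ ∨ (∃ m, A = {m}) ∨ A ∈ F}

/-- `P(M, F)` is ordered by reverse inclusion. -/
instance {M : Type u} (F : Set (Set M)) : PartialOrder (ReducedPoset F) where
  le A B := B.1 ⊆ A.1
  le_refl _ := subset_rfl
  le_trans _ _ _ h h' := Set.Subset.trans h' h
  le_antisymm _ _ h h' := Subtype.ext (Set.Subset.antisymm h' h)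

/-- The family `{{a, b}, M - {a}, M - {b}}`. -/
def specialFamily {M : Type u} (a b : M) : Set (Set M) := {{a, b}, {a}ᶜ, {b}ᶜ}

open Set

/-!
For part 1, `ε(P(M, E))` with `E` the full special family generates, together with `Pa_m`, a
quasivariety strictly between `Pa_m` and `Q(ε(P(M, F)))`. It belongs to `Q(ε(P(M, F)))` because
pp-morphisms `P(M, F) → P(M, E)` hit every point. It lies outside the variety `Pa_m` because it
violates Lee's condition, that the pseudocomplements of `m + 1` pairwise disjoint elements join to
`⊤`: the atoms `{{x}}` are disjoint, and the join of their pseudocomplements omits the point `M`.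
Finally, "every homomorphism from `ε(P(M, F))` sends `P(M, F) - {M}` to `⊤`" is a quasi-identity
since `ε(P(M, F))` is finite. It fails in `ε(P(M, F))` itself, holds in `Pa_m` by Lee's condition,
and holds in `ε(P(M, E))` because, dually, no pp-morphism `P(M, E) → P(M, F)` attains the value `M`.

Pp-morphisms of reduced posets are induced by maps `f : M → M`. If `M` is a value, then `f` is a
permutation carrying the source family into the target family. Conversely such a permutation can be
followed by endomorphisms of `P(M, G)` that send `M` to any prescribed element. A permutation of
`M` thus provides an injection `F → G`, which extends to a size-preserving permutation of `E`; in
the other direction every size-preserving permutation of `E` is induced by a permutation of `M`,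
as it must send `{a}ᶜ`, `{b}ᶜ`, `{a, b}` to `{a'}ᶜ`, `{b'}ᶜ`, `{a', b'}`.
-/

section Homomorphisms

variable {A B : Type*} [PAlgebra A] [PAlgebra B] {f : A → B}

/-- A p-algebra homomorphism as a bundled homomorphism of bounded lattices, which makes the
lemmas on finite joins and meets available. -/
def IsPAlgebraHom.toBoundedLatticeHom (hf : IsPAlgebraHom f) : BoundedLatticeHom A B where
  toFun := f
  map_sup' := hf.map_sup
  map_inf' := hf.map_inf
  map_top' := hf.map_top
  map_bot' := hf.map_bot

theorem isPAlgebraHom_id : IsPAlgebraHom (id : A → A) :=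
  ⟨rfl, rfl, fun _ _ => rfl, fun _ _ => rfl, fun _ => rfl⟩

namespace IsPAlgebraHom

theorem map_finset_sup (hf : IsPAlgebraHom f) {ι : Type*} (s : Finset ι) (x : ι → A) :
    f (s.sup x) = s.sup fun i => f (x i) :=
  _root_.map_finset_sup hf.toBoundedLatticeHom s x

theorem map_finset_inf (hf : IsPAlgebraHom f) {ι : Type*} (s : Finset ι) (x : ι → A) :
    f (s.inf x) = s.inf fun i => f (x i) :=
  _root_.map_finset_inf hf.toBoundedLatticeHom s x

theorem map_disjoint (hf : IsPAlgebraHom f) {x y : A} (h : Disjoint x y) :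
    Disjoint (f x) (f y) :=
  h.map hf.toBoundedLatticeHom

theorem map_eval (hf : IsPAlgebraHom f) (v : ℕ → A) (t : PTerm) :
    f (t.eval v) = t.eval (f ∘ v) := by
  induction t with
  | var n => rfl
  | bot => exact hf.map_bot
  | top => exact hf.map_top
  | inf s t hs ht => rw [PTerm.eval, PTerm.eval, hf.map_inf, hs, ht]
  | sup s t hs ht => rw [PTerm.eval, PTerm.eval, hf.map_sup, hs, ht]
  | star t ht => rw [PTerm.eval, PTerm.eval, hf.map_star, ht]

end IsPAlgebraHom

theorem QuasiIdentity.HoldsIn.of_separating {q : QuasiIdentity} (hq : q.HoldsIn B)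
    (hsep : ∀ x y : A, (∀ f : A → B, IsPAlgebraHom f → f x = f y) → x = y) :
    q.HoldsIn A := by
  refine fun v hv => hsep _ _ fun f hf => ?_
  rw [hf.map_eval, hf.map_eval]
  refine hq _ fun e he => ?_
  rw [← hf.map_eval, ← hf.map_eval, hv e he]

end Homomorphisms

theorem not_isQuasivarietyCover_of_holdsIn {V : Set PAlg.{u}} {A B : PAlg.{u}}
    (hBA : B ∈ quasivarietyOf A) (hBV : B ∉ V) {q : QuasiIdentity}
    (hV : ∀ C ∈ V, q.HoldsIn C.carrier) (hB : q.HoldsIn B.carrier) (hA : ¬ q.HoldsIn A.carrier) :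
    ¬ IsQuasivarietyCover V (quasivarietyOf A) := by
  rintro ⟨hVA, hcover⟩
  -- The quasivariety generated by `V` and `B` lies strictly between `V` and `Q(A)`.
  let S : Set QuasiIdentity := {r | (∀ C ∈ V, r.HoldsIn C.carrier) ∧ r.HoldsIn B.carrier}
  let L : Set PAlg.{u} := {C | ∀ r ∈ S, r.HoldsIn C.carrier}
  have hVL : V ⊆ L := fun C hC r hr => hr.1 C hC
  have hLA : L ⊆ quasivarietyOf A := fun C hC r hr =>
    hC r ⟨fun D hD => hVA.1 hD r hr, hBA r hr⟩
  have hBL : B ∈ L := fun r hr => hr.2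
  have hAL : A ∉ L := fun h => hA (h q ⟨hV, hB⟩)
  rcases hcover L ⟨S, rfl⟩ hVL hLA with hL | hL
  · exact hBV (hL ▸ hBL)
  · exact hAL (hL ▸ fun r hr => hr)

namespace PTerm

/-- The diagram of the p-algebra `A`: its operation tables written as equations between terms,
with the variable of index `c x` standing for the element `x`. -/
def diagram {A : Type*} [PAlgebra A] (c : A → ℕ) : Set (PTerm × PTerm) :=
  {(var (c ⊥), bot), (var (c ⊤), top)} ∪
    range (fun x => (var (c (PAlgebra.star x)), star (var (c x)))) ∪
    range (fun p : A × A => (var (c (p.1 ⊓ p.2)), inf (var (c p.1)) (var (c p.2)))) ∪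
    range (fun p : A × A => (var (c (p.1 ⊔ p.2)), sup (var (c p.1)) (var (c p.2))))

variable {A B : Type*} [PAlgebra A] [PAlgebra B] {c : A → ℕ}

theorem finite_diagram [Finite A] : (diagram c).Finite :=
  (((toFinite _).union (finite_range _)).union (finite_range _)).union (finite_range _)

theorem forall_mem_diagram_iff {v : ℕ → B} :
    (∀ e ∈ diagram c, e.1.eval v = e.2.eval v) ↔ IsPAlgebraHom (v ∘ c) := by
  simp only [diagram, mem_union, mem_insert_iff, mem_singleton_iff, or_imp, forall_and,
    forall_eq, forall_mem_range, Prod.forall, PTerm.eval]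
  exact ⟨fun ⟨⟨⟨⟨hbot, htop⟩, hstar⟩, hinf⟩, hsup⟩ => ⟨hbot, htop, hinf, hsup, hstar⟩,
    fun h => ⟨⟨⟨⟨h.map_bot, h.map_top⟩, h.map_star⟩, h.map_inf⟩, h.map_sup⟩⟩

end PTerm

theorem QuasiIdentity.exists_holdsIn_iff_forall_hom {A : Type u} [PAlgebra A] [Finite A]
    (x y : A) : ∃ q : QuasiIdentity, ∀ (B : Type v) [PAlgebra B],
      q.HoldsIn B ↔ ∀ f : A → B, IsPAlgebraHom f → f x = f y := by
  obtain ⟨c, hc⟩ := exists_injective_nat A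
  refine ⟨⟨(PTerm.finite_diagram (c := c)).toFinset.toList, .var (c x), .var (c y)⟩,
    fun B _ => ?_⟩
  simp only [QuasiIdentity.HoldsIn, Finset.mem_toList, Finite.mem_toFinset,
    PTerm.forall_mem_diagram_iff, PTerm.eval]
  refine ⟨fun h f hf => ?_, fun h v hv => h (v ∘ c) hv⟩
  have hext : Function.extend c f ⊥ ∘ c = f := Function.extend_comp hc f ⊥
  simpa only [hc.extend_apply] using h (Function.extend c f ⊥) (hext.symm ▸ hf)

/-! ### Lee's condition -/

namespace PAlgebra

variable {A B : Type*} [PAlgebra A] [PAlgebra B]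

theorem le_star_iff_disjoint {x y : A} : x ≤ star y ↔ Disjoint x y :=
  (le_star_iff x y).trans disjoint_iff.symm

theorem star_bot : star (⊥ : A) = ⊤ :=
  top_le_iff.1 (le_star_iff_disjoint.2 disjoint_bot_right)

theorem exists_pairwise_disjoint_lift {ι : Type*} [Finite ι] {f : A → B}
    (hf : IsPAlgebraHom f) (hsurj : Function.Surjective f) {x : ι → B}
    (hx : Pairwise (Function.onFun Disjoint x)) :
    ∃ y : ι → A, Pairwise (Function.onFun Disjoint y) ∧ ∀ i, f (y i) = x i := by
  classical
  have := Fintype.ofFinite ι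
  choose c hc using fun i => hsurj (x i)
  refine ⟨fun i => c i ⊓ (Finset.univ.erase i).inf fun j => star (c j), fun i j hij => ?_,
    fun i => ?_⟩
  · have hi : c i ⊓ (Finset.univ.erase i).inf (fun j => star (c j)) ≤ star (c j) :=
      inf_le_right.trans (Finset.inf_le (by simp [hij.symm]))
    exact (le_star_iff_disjoint.1 hi).mono_right inf_le_left
  · simp only [hf.map_inf, hf.map_finset_inf, hf.map_star, hc]
    exact inf_eq_left.2 (Finset.le_inf fun j hj =>
      le_star_iff_disjoint.2 (hx (Finset.ne_of_mem_erase hj).symm))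

/-- Lee's condition: the pseudocomplements of any `ι`-indexed pairwise disjoint elements join
to `⊤`. With `m + 1` indices it holds throughout `Pa_m`. -/
def LeeCondition (ι : Type*) [Fintype ι] (A : Type*) [PAlgebra A] : Prop :=
  ∀ x : ι → A, Pairwise (Function.onFun Disjoint x) → Finset.univ.sup (fun i => star (x i)) = ⊤

variable {ι : Type*} [Fintype ι]

theorem LeeCondition.power {I : Type u} {B : Type v} [PAlgebra B] (h : LeeCondition ι B) :
    LeeCondition ι (I → B) := by
  intro x hx
  funext k
  rw [Finset.sup_apply]
  exact h (fun i => x i k) fun i j hij => Pi.disjoint_iff.1 (hx hij) k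

theorem LeeCondition.of_injective (h : LeeCondition ι B) {g : A → B} (hg : IsPAlgebraHom g)
    (hinj : Function.Injective g) : LeeCondition ι A := by
  intro x hx
  apply hinj
  rw [hg.map_top, hg.map_finset_sup]
  simp only [hg.map_star]
  exact h (g ∘ x) fun i j hij => hg.map_disjoint (hx hij)

theorem LeeCondition.of_surjective (h : LeeCondition ι A) {f : A → B} (hf : IsPAlgebraHom f)
    (hsurj : Function.Surjective f) : LeeCondition ι B := by
  intro x hx
  obtain ⟨y, hy, hfy⟩ := exists_pairwise_disjoint_lift hf hsurj hx
  simpa only [hf.map_finset_sup, hf.map_star, hfy, hf.map_top] using congrArg f (h y hy)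

end PAlgebra

namespace BBar

variable {m : ℕ}

/-- The atom `{p}` of the Boolean algebra inside `B̄_m`. -/
def atom (p : Fin m) : BBar m := (({p} : Set (Fin m)) : WithTop (Set (Fin m)))

theorem atom_ne_bot (p : Fin m) : atom p ≠ ⊥ := fun h =>
  singleton_ne_empty p (WithTop.coe_injective h)

theorem exists_atom_le (hm : 0 < m) {z : BBar m} (hz : z ≠ ⊥) : ∃ p, atom p ≤ z := by
  change WithTop (Set (Fin m)) at z
  induction z using WithTop.recTopCoe with
  | top => exact ⟨⟨0, hm⟩, le_top (α := BBar m)⟩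
  | coe s =>
    obtain ⟨p, hp⟩ : s.Nonempty := nonempty_iff_ne_empty.2 fun hs => hz (congrArg _ hs)
    exact ⟨p, WithTop.coe_le_coe.2 (singleton_subset_iff.2 hp)⟩

theorem exists_eq_bot_of_pairwise_disjoint {ι : Type*} [Fintype ι] (hm : 0 < m)
    (hι : m < Fintype.card ι) {x : ι → BBar m} (hx : Pairwise (Function.onFun Disjoint x)) :
    ∃ i, x i = ⊥ := by
  by_contra! hne
  choose p hp using fun i => exists_atom_le hm (hne i)
  obtain ⟨i, j, hij, hpij⟩ := Fintype.exists_ne_map_eq_of_card_lt p (by rwa [Fintype.card_fin])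
  exact atom_ne_bot (p i) (le_bot_iff.1 (hx hij (hp i) (hpij ▸ hp j)))

theorem leeCondition {ι : Type*} [Fintype ι] (hm : 0 < m) (hι : m < Fintype.card ι) :
    PAlgebra.LeeCondition ι (BBar m) := by
  intro x hx
  obtain ⟨i, hi⟩ := exists_eq_bot_of_pairwise_disjoint hm hι hx
  refine top_le_iff.1 (le_trans ?_ (Finset.le_sup (Finset.mem_univ i)))
  rw [hi, PAlgebra.star_bot]

end BBar

theorem leeCondition_of_mem_Pa {ι : Type*} [Fintype ι] {m : ℕ} (hm : 0 < m)
    (hι : m < Fintype.card ι) {A : PAlg.{u}} (hA : A ∈ Pa m) :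
    PAlgebra.LeeCondition ι A.carrier := by
  obtain ⟨I, C, g, f, hg, hginj, hf, hfsurj⟩ := hA
  exact ((BBar.leeCondition hm hι).power.of_injective hg hginj).of_surjective hf hfsurj

/-! ### Upsets and pp-morphisms -/

namespace Upset

variable {P : Type*} [PartialOrder P]

instance [Finite P] : Finite (Upset P) := inferInstanceAs (Finite {U : Set P // IsUpperSet U})

/-- The principal upset `↑p`. -/
def principal (p : P) : Upset P := ⟨Ici p, isUpperSet_Ici p⟩

/-- The upset of all elements but the least one. -/
def complBot (P : Type*) [PartialOrder P] [OrderBot P] : Upset P :=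
  ⟨{⊥}ᶜ, fun _ _ hxy hx hy => hx (le_bot_iff.1 (hxy.trans_eq hy))⟩

theorem complBot_ne_top [OrderBot P] : complBot P ≠ ⊤ := fun h =>
  (congrArg Subtype.val h).ge (mem_univ ⊥) rfl

theorem mem_finset_sup {ι : Type*} {s : Finset ι} {U : ι → Upset P} {x : P} :
    x ∈ (s.sup U).1 ↔ ∃ i ∈ s, x ∈ (U i).1 := by
  classical
  induction s using Finset.induction_on with
  | empty => exact ⟨fun h => absurd h (notMem_empty x), by simp⟩
  | insert i s _ ih =>
    rw [Finset.sup_insert]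
    change x ∈ (U i).1 ∪ (s.sup U).1 ↔ _
    simp [ih]

theorem sup_principal [Fintype P] (U : Upset P) [DecidablePred (· ∈ U.1)] :
    (Finset.univ.filter (· ∈ U.1)).sup principal = U := by
  refine Subtype.ext (Set.ext fun p => ?_)
  simp only [mem_finset_sup, Finset.mem_filter_univ]
  exact ⟨fun ⟨_, hq, hqp⟩ => U.2 hqp hq, fun hp => ⟨p, hp, le_refl p⟩⟩

end Upset

section Duality

variable {P Q : Type*} [PartialOrder P] [PartialOrder Q]

theorem nonempty_maxAbove [Finite P] (x : P) : (maxAbove x).Nonempty := by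
  obtain ⟨y, hxy, hy⟩ := Finite.exists_le_maximal (le_refl x)
  exact ⟨y, hxy, fun z hz => hy.2 (hxy.trans hz) hz⟩

/-- The preimage of an upset under a monotone map; for a pp-morphism `h` this is the dual
`ε(h)`. -/
def Upset.preimage {h : P → Q} (hh : Monotone h) (U : Upset Q) : Upset P :=
  ⟨h ⁻¹' U.1, U.2.preimage hh⟩

theorem IsPPMorphism.exists_le_apply [Finite Q] {h : P → Q} (hh : IsPPMorphism h) {x : P} {y : Q}
    (hxy : h x ≤ y) : ∃ z, x ≤ z ∧ y ≤ h z := by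
  obtain ⟨w, hyw, hw⟩ := nonempty_maxAbove y
  obtain ⟨z, ⟨hxz, -⟩, rfl⟩ := (hh.map_maxAbove x).subset ⟨hxy.trans hyw, hw⟩
  exact ⟨z, hxz, hyw⟩

theorem isPPMorphism_of_exists_le_apply [Finite P] {h : P → Q} (hmono : Monotone h)
    (hlift : ∀ x y, h x ≤ y → ∃ z, x ≤ z ∧ y ≤ h z) : IsPPMorphism h where
  monotone := hmono
  map_maxAbove x := by
    apply Subset.antisymm
    · rintro y ⟨hxy, hy⟩
      obtain ⟨z, hxz, hyz⟩ := hlift x y hxy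
      obtain ⟨w, hzw, hw⟩ := nonempty_maxAbove z
      exact ⟨w, ⟨hxz.trans hzw, hw⟩, (hy.eq_of_le (hyz.trans (hmono hzw))).symm⟩
    · rintro _ ⟨w, ⟨hxw, hw⟩, rfl⟩
      refine ⟨hmono hxw, fun y hy => ?_⟩
      obtain ⟨z, hwz, hyz⟩ := hlift w y hy
      exact hyz.trans (hmono (hw hwz))

theorem IsPPMorphism.isPAlgebraHom_preimage [Finite Q] {h : P → Q} (hh : IsPPMorphism h) :
    IsPAlgebraHom (Upset.preimage hh.monotone) where
  map_bot := rfl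
  map_top := rfl
  map_inf _ _ := rfl
  map_sup _ _ := rfl
  map_star U := by
    refine Subtype.ext (Set.ext fun x => ⟨fun hx y hxy => hx _ (hh.monotone hxy), ?_⟩)
    intro hx y hxy hyU
    obtain ⟨z, hxz, hyz⟩ := hh.exists_le_apply hxy
    exact hx z hxz (U.2 hyz hyU)

namespace IsPAlgebraHom

variable [Finite P] {g : Upset P → Upset Q}

theorem exists_mem_principal (hg : IsPAlgebraHom g) {U : Upset P} {y : Q} (hy : y ∈ (g U).1) :
    ∃ p ∈ U.1, y ∈ (g (Upset.principal p)).1 := by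
  classical
  have := Fintype.ofFinite P
  rw [← Upset.sup_principal U, hg.map_finset_sup, Upset.mem_finset_sup] at hy
  simpa only [Finset.mem_filter_univ] using hy

/-- The prime filter of all upsets whose image contains a given point is principal. -/
theorem exists_mem_iff_mem (hg : IsPAlgebraHom g) (y : Q) :
    ∃ p : P, ∀ U, y ∈ (g U).1 ↔ p ∈ U.1 := by
  obtain ⟨p₀, -, hp₀⟩ := hg.exists_mem_principal (U := ⊤) (y := y) (hg.map_top ▸ mem_univ y)
  obtain ⟨p, -, hp, hmax⟩ :=
    Finite.exists_le_maximal (p := fun p => y ∈ (g (Upset.principal p)).1) hp₀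
  refine ⟨p, fun U => ⟨fun hU => ?_, fun hU => ?_⟩⟩
  · have hmem : y ∈ (g (Upset.principal p ⊓ U)).1 := by
      rw [hg.map_inf]
      exact ⟨hp, hU⟩
    obtain ⟨q, ⟨hpq, hqU⟩, hq⟩ := hg.exists_mem_principal hmem
    exact U.2 (hmax hq hpq) hqU
  · have hle : Upset.principal p ≤ U := fun z hz => U.2 hz hU
    exact OrderHomClass.mono hg.toBoundedLatticeHom hle hp

/-- Duality between finite posets and finite p-algebras, on morphisms. -/
theorem exists_isPPMorphism [Finite Q] (hg : IsPAlgebraHom g) :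
    ∃ h : Q → P, IsPPMorphism h ∧ ∀ U, (g U).1 = h ⁻¹' U.1 := by
  choose h hmem using hg.exists_mem_iff_mem
  have hmono : Monotone h := fun y z hyz =>
    (hmem z _).1 ((g _).2 hyz ((hmem y (Upset.principal (h y))).2 (le_refl (h y))))
  refine ⟨h, isPPMorphism_of_exists_le_apply hmono fun y p hyp => ?_,
    fun U => Set.ext fun y => hmem y U⟩
  -- `h y` lies outside `(↑p)*`, hence `y` lies outside `g ((↑p)*) = (g ↑p)*`.
  by_contra! hlift
  have hy : y ∈ (g (PAlgebra.star (Upset.principal p))).1 := by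
    rw [hg.map_star]
    exact fun z hyz hz => hlift z hyz ((hmem z _).1 hz)
  exact (hmem y _).1 hy p hyp (le_refl p)

theorem map_complBot_eq_top [Finite Q] [OrderBot P]
    {g : Upset P → Upset Q} (hg : IsPAlgebraHom g)
    (hbot : ∀ h : Q → P, IsPPMorphism h → ⊥ ∉ range h) : g (Upset.complBot P) = ⊤ := by
  obtain ⟨h, hh, hgh⟩ := hg.exists_isPPMorphism
  exact Subtype.ext ((hgh _).trans (eq_univ_of_forall fun y hy => hbot h hh ⟨y, hy⟩))

end IsPAlgebraHom

end Duality

/-! ### Covering by pp-morphisms -/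

/-- Every point of `Q` lies in the image of a pp-morphism `P → Q`. For finite `Q` this says that
`Q` is a pp-morphic image of a disjoint union of finitely many copies of `P`. -/
def PPCovers (P Q : Type*) [PartialOrder P] [PartialOrder Q] : Prop :=
  ∀ y : Q, ∃ h : P → Q, IsPPMorphism h ∧ y ∈ range h

section Copies

variable {P Q : Type*} [PartialOrder P] [PartialOrder Q] {ι : Type*}

theorem isMax_sigma_mk_iff {i : ι} {x : P} : IsMax (⟨i, x⟩ : Σ _ : ι, P) ↔ IsMax x := by
  constructor
  · intro h y hy
    obtain ⟨_, _, _, hyx⟩ : (⟨i, y⟩ : Σ _ : ι, P) ≤ ⟨i, x⟩ := h (Sigma.mk_le_mk_iff.2 hy)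
    exact hyx
  · rintro h _ ⟨_, _, y, hy⟩
    exact Sigma.mk_le_mk_iff.2 (h hy)

theorem maxAbove_sigma_mk (i : ι) (x : P) :
    maxAbove (⟨i, x⟩ : Σ _ : ι, P) = (fun y => (⟨i, y⟩ : Σ _ : ι, P)) '' maxAbove x := by
  ext z
  constructor
  · rintro ⟨⟨_, _, y, hxy⟩, hy⟩
    exact ⟨y, ⟨hxy, isMax_sigma_mk_iff.1 hy⟩, rfl⟩
  · rintro ⟨y, ⟨hxy, hy⟩, rfl⟩
    exact ⟨Sigma.mk_le_mk_iff.2 hxy, isMax_sigma_mk_iff.2 hy⟩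

theorem isPPMorphism_sigma_iff {h : (Σ _ : ι, P) → Q} :
    IsPPMorphism h ↔ ∀ i, IsPPMorphism fun x => h ⟨i, x⟩ := by
  constructor
  · refine fun hh i => ⟨fun x y hxy => hh.monotone (Sigma.mk_le_mk_iff.2 hxy), fun x => ?_⟩
    rw [hh.map_maxAbove, maxAbove_sigma_mk, image_image]
  · refine fun hh => ⟨?_, fun ⟨i, x⟩ => ?_⟩
    · rintro _ _ ⟨i, x, y, hxy⟩
      exact (hh i).monotone hxy
    · rw [(hh i).map_maxAbove x, maxAbove_sigma_mk, image_image]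

theorem exists_surjective_copies_iff_ppCovers [Finite Q] :
    (∃ (n : ℕ) (h : (Σ _ : Fin n, P) → Q), IsPPMorphism h ∧ Function.Surjective h) ↔
      PPCovers P Q := by
  constructor
  · rintro ⟨n, h, hh, hsurj⟩ y
    obtain ⟨⟨i, x⟩, rfl⟩ := hsurj y
    exact ⟨fun x => h ⟨i, x⟩, isPPMorphism_sigma_iff.1 hh i, x, rfl⟩
  · intro hcov
    obtain ⟨n, ⟨e⟩⟩ := Finite.exists_equiv_fin Q
    choose h hh x hx using hcov
    refine ⟨n, fun z => h (e.symm z.1) z.2, isPPMorphism_sigma_iff.2 fun i => hh (e.symm i),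
      fun y => ⟨⟨e y, x y⟩, ?_⟩⟩
    simpa only [e.symm_apply_apply] using hx y

end Copies

section Quasivariety

variable {P Q : Type u} [PartialOrder P] [PartialOrder Q]

theorem PPCovers.dualAlg_mem_quasivarietyOf [Finite Q] (hcov : PPCovers P Q) :
    dualAlg Q ∈ quasivarietyOf (dualAlg P) := by
  refine fun q hq => hq.of_separating fun U V hUV => Subtype.ext (Set.ext fun y => ?_)
  obtain ⟨h, hh, x, rfl⟩ := hcov y
  have hpre := congrArg Subtype.val
    (hUV (Upset.preimage hh.monotone) hh.isPAlgebraHom_preimage)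
  exact Set.ext_iff.1 hpre x

end Quasivariety

/-! ### Reduced posets -/

namespace ReducedPoset

variable {M N : Type*} {F : Set (Set M)} {G : Set (Set N)}

/-- The family of sets underlying `P(M, F)`. -/
def carrier (F : Set (Set M)) : Set (Set M) := {A | A = univ ∨ (∃ x, A = {x}) ∨ A ∈ F}

theorem univ_mem_carrier : univ ∈ carrier F := .inl rfl

theorem singleton_mem_carrier (x : M) : {x} ∈ carrier F := .inr (.inl ⟨x, rfl⟩)

theorem mem_carrier_of_mem {X : Set M} (hX : X ∈ F) : X ∈ carrier F := .inr (.inr hX)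

theorem mem_of_mem_carrier {X : Set M} (hX : X ∈ carrier F) (huniv : X ≠ univ)
    (hnt : X.Nontrivial) : X ∈ F := by
  rcases hX with h | ⟨x, rfl⟩ | h
  · exact absurd h huniv
  · exact absurd hnt not_nontrivial_singleton
  · exact h

instance [Finite M] : Finite (ReducedPoset F) := inferInstanceAs (Finite (carrier F))

instance : OrderBot (ReducedPoset F) where
  bot := ⟨univ, univ_mem_carrier⟩
  bot_le p := subset_univ p.1

theorem coe_bot : (⊥ : ReducedPoset F).1 = univ := rfl

/-- The singleton `{x}` as an element of `P(M, F)`. -/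
def point (x : M) : ReducedPoset F := ⟨{x}, singleton_mem_carrier x⟩

theorem point_injective : Function.Injective (point : M → ReducedPoset F) := fun _ _ h =>
  singleton_injective (congrArg Subtype.val h)

theorem le_point_iff {p : ReducedPoset F} {x : M} : p ≤ point x ↔ x ∈ p.1 :=
  singleton_subset_iff

section Maximal

variable [Nonempty M] (hF : ∀ X ∈ F, X.Nonempty)
include hF

theorem nonempty_coe (p : ReducedPoset F) : p.1.Nonempty := by
  rcases p.2 with h | ⟨x, h⟩ | h
  · rw [h]
    exact univ_nonempty
  · rw [h]
    exact singleton_nonempty x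
  · exact hF _ h

theorem isMax_iff {p : ReducedPoset F} : IsMax p ↔ ∃ x, p = point x := by
  constructor
  · intro hp
    obtain ⟨x, hx⟩ := nonempty_coe hF p
    exact ⟨x, hp.eq_of_le (le_point_iff.2 hx)⟩
  · rintro ⟨x, rfl⟩ q hq
    exact ((nonempty_coe hF q).subset_singleton_iff.1 hq).ge

theorem maxAbove_eq (p : ReducedPoset F) : maxAbove p = point '' p.1 := by
  ext q
  constructor
  · rintro ⟨hpq, hq⟩
    obtain ⟨x, rfl⟩ := (isMax_iff hF).1 hq
    exact ⟨x, le_point_iff.1 hpq, rfl⟩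
  · rintro ⟨x, hx, rfl⟩
    exact ⟨le_point_iff.2 hx, (isMax_iff hF).2 ⟨x, rfl⟩⟩

end Maximal

section PPMorphisms

variable [Nonempty M] [Nonempty N]

/-- The map `f` is the restriction of `h` to the maximal elements. -/
theorem isPPMorphism_iff_exists_image_eq (hF : ∀ X ∈ F, X.Nonempty) (hG : ∀ X ∈ G, X.Nonempty)
    {h : ReducedPoset F → ReducedPoset G} :
    IsPPMorphism h ↔ ∃ f : M → N, ∀ p, (h p).1 = f '' p.1 := by
  constructor
  · intro hh
    have hmax : ∀ x, ∃ y, h (point x) = point y := fun x => by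
      have hx : point x ∈ maxAbove (point x : ReducedPoset F) :=
        ⟨le_rfl, (isMax_iff hF).2 ⟨x, rfl⟩⟩
      exact (isMax_iff hG).1 ((hh.map_maxAbove (point x)).ge (mem_image_of_mem h hx)).2
    choose f hf using hmax
    refine ⟨f, fun p => (point_injective (F := G)).image_injective ?_⟩
    rw [← maxAbove_eq hG, hh.map_maxAbove, maxAbove_eq hF, image_image, image_image]
    simp only [hf]
  · rintro ⟨f, hf⟩
    have hpoint : ∀ x, point (f x) = h (point x) := fun x =>
      Subtype.ext ((hf (point x)).trans image_singleton).symm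
    refine ⟨fun p q hpq => ?_, fun p => ?_⟩
    · change (h q).1 ⊆ (h p).1
      rw [hf, hf]
      exact image_mono hpq
    · rw [maxAbove_eq hG, hf, maxAbove_eq hF, image_image, image_image]
      simp only [hpoint]

theorem exists_isPPMorphism_coe_eq_image (hF : ∀ X ∈ F, X.Nonempty) (hG : ∀ X ∈ G, X.Nonempty)
    {f : M → N} (hrange : range f ∈ carrier G) (hf : ∀ X ∈ F, f '' X ∈ carrier G) :
    ∃ h : ReducedPoset F → ReducedPoset G, IsPPMorphism h ∧ ∀ p, (h p).1 = f '' p.1 := by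
  have hcarrier : ∀ X ∈ carrier F, f '' X ∈ carrier G := by
    rintro X (rfl | ⟨x, rfl⟩ | hX)
    · rwa [image_univ]
    · exact image_singleton ▸ singleton_mem_carrier (f x)
    · exact hf X hX
  let h : ReducedPoset F → ReducedPoset G := fun p => ⟨f '' p.1, hcarrier p.1 p.2⟩
  exact ⟨h, (isPPMorphism_iff_exists_image_eq hF hG).2 ⟨f, fun _ => rfl⟩, fun _ => rfl⟩

end PPMorphisms

theorem exists_perm_image_mem_of_bot_mem_range [Finite M] [Nonempty M] {F G : Set (Set M)}
    (hF : ∀ X ∈ F, X.Nontrivial ∧ X ≠ univ) (hG : ∀ X ∈ G, X.Nonempty)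
    {h : ReducedPoset F → ReducedPoset G} (hh : IsPPMorphism h) (hbot : ⊥ ∈ range h) :
    ∃ τ : Equiv.Perm M, ∀ X ∈ F, τ '' X ∈ G := by
  obtain ⟨f, hf⟩ := (isPPMorphism_iff_exists_image_eq (fun X hX => (hF X hX).1.nonempty) hG).1 hh
  obtain ⟨p, hp⟩ := hbot
  have himage : f '' p.1 = univ := by rw [← hf, hp, coe_bot]
  have hsurj : Function.Surjective f := fun y => by
    obtain ⟨x, -, hx⟩ := himage.ge (mem_univ y)
    exact ⟨x, hx⟩
  have hinj : Function.Injective f := Finite.injective_iff_surjective.2 hsurj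
  refine ⟨Equiv.ofBijective f ⟨hinj, hsurj⟩, fun X hX => ?_⟩
  have hcarrier : f '' X ∈ carrier G := hf ⟨X, mem_carrier_of_mem hX⟩ ▸ (h _).2
  refine mem_of_mem_carrier hcarrier (fun huniv => (hF X hX).2 ?_) ((hF X hX).1.image hinj)
  exact hinj.image_injective (huniv.trans (image_univ_of_surjective hsurj).symm)

section Atoms

variable [Nonempty M] (hF : ∀ X ∈ F, X.Nonempty)

/-- The atom `{{x}}` of the algebra of upsets of `P(M, F)`. -/
def atom (x : M) : Upset (ReducedPoset F) :=
  ⟨{point x}, by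
    rintro _ q hq rfl
    exact (((isMax_iff hF).2 ⟨x, rfl⟩).eq_of_le hq).symm⟩

theorem pairwise_disjoint_atom : Pairwise (Function.onFun Disjoint (atom hF)) := by
  refine fun x y hxy => disjoint_iff.2 (Subtype.ext ?_)
  exact (disjoint_singleton.2 (point_injective.ne hxy)).inter_eq

theorem mem_star_atom_iff {x : M} {p : ReducedPoset F} :
    p ∈ (PAlgebra.star (atom hF x)).1 ↔ x ∉ p.1 := by
  rw [← le_point_iff]
  exact ⟨fun h hp => h _ hp rfl, fun h q hpq hq => h (hpq.trans_eq hq)⟩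

theorem sup_star_atom [Fintype M] :
    Finset.univ.sup (fun x => PAlgebra.star (atom hF x)) = Upset.complBot (ReducedPoset F) := by
  refine Subtype.ext (Set.ext fun p => ?_)
  simp only [Upset.mem_finset_sup, Finset.mem_univ, true_and, mem_star_atom_iff]
  rw [← ne_univ_iff_exists_notMem]
  exact not_congr ⟨fun h => Subtype.ext h, congrArg Subtype.val⟩

include hF in
theorem not_leeCondition_upset [Fintype M] : ¬ PAlgebra.LeeCondition M (Upset (ReducedPoset F)) :=
  fun h => Upset.complBot_ne_top <|
    (sup_star_atom hF).symm.trans (h (atom hF) (pairwise_disjoint_atom hF))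

include hF in
theorem map_complBot_eq_top_of_leeCondition [Fintype M] {A : Type*} [PAlgebra A]
    (hA : PAlgebra.LeeCondition M A) {g : Upset (ReducedPoset F) → A} (hg : IsPAlgebraHom g) :
    g (Upset.complBot (ReducedPoset F)) = ⊤ := by
  rw [← sup_star_atom hF, hg.map_finset_sup]
  simp only [hg.map_star]
  exact hA _ fun x y hxy => hg.map_disjoint (pairwise_disjoint_atom hF hxy)

end Atoms

theorem not_isQuasivarietyCover_of_ppCovers {M : Type u} [Finite M] [Nonempty M]
    {F G : Set (Set M)} {m : ℕ} (hm : 0 < m) (hM : m < Nat.card M)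
    (hF : ∀ X ∈ F, X.Nonempty) (hG : ∀ X ∈ G, X.Nonempty)
    (hcov : PPCovers (ReducedPoset F) (ReducedPoset G))
    (hbot : ∀ h : ReducedPoset G → ReducedPoset F, IsPPMorphism h → ⊥ ∉ range h) :
    ¬ IsQuasivarietyCover (Pa m) (quasivarietyOf (dualAlg (ReducedPoset F))) := by
  have := Fintype.ofFinite M
  have hLee : ∀ A ∈ Pa.{u} m, PAlgebra.LeeCondition M A.carrier := fun A hA =>
    leeCondition_of_mem_Pa hm (Nat.card_eq_fintype_card (α := M) ▸ hM) hA
  obtain ⟨q, hq⟩ := QuasiIdentity.exists_holdsIn_iff_forall_hom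
    (Upset.complBot (ReducedPoset F)) ⊤
  refine not_isQuasivarietyCover_of_holdsIn hcov.dualAlg_mem_quasivarietyOf
    (fun h => not_leeCondition_upset hG (hLee _ h)) (q := q) (fun A hA => ?_) ?_ fun h => ?_
  · exact (hq _).2 fun g hg =>
      (map_complBot_eq_top_of_leeCondition hF (hLee A hA) hg).trans hg.map_top.symm
  · exact (hq _).2 fun g hg => (hg.map_complBot_eq_top hbot).trans hg.map_top.symm
  · exact Upset.complBot_ne_top ((hq _).1 h id isPAlgebraHom_id)

end ReducedPoset

/-! ### The special family -/

theorem exists_perm_extend_of_injective {α β : Type*} [Finite α] (c : α → β) {s : Set α}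
    {i : s → α} (hi : Function.Injective i) (hc : ∀ x, c (i x) = c x) :
    ∃ σ : Equiv.Perm α, (∀ x, c (σ x) = c x) ∧ ∀ x, σ x.1 = i x := by
  have hfiber : ∀ k, ∃ e : Equiv.Perm {x // c x = k}, ∀ x hx, (e x).1 = i ⟨x.1, hx⟩ := by
    intro k
    let j : {x : {x // c x = k} // x.1 ∈ s} → {x // c x = k} := fun x =>
      ⟨i ⟨x.1.1, x.2⟩, (hc _).trans x.1.2⟩
    have hj : Function.Injective j := fun x y hxy =>
      Subtype.ext <| Subtype.ext <| Subtype.mk.inj (hi (congrArg Subtype.val hxy))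
    obtain ⟨e, he⟩ := Equiv.Perm.exists_extending_pair _ j Subtype.val_injective hj
    exact ⟨e, fun x hx => congrArg Subtype.val (he ⟨x, hx⟩)⟩
  choose e he using hfiber
  exact ⟨Equiv.ofFiberEquiv e, Equiv.ofFiberEquiv_map e, fun x => he (c x) ⟨x, rfl⟩ x.2⟩

section SpecialFamily

variable {M : Type u} {a b : M}

theorem specialFamily_comm (a b : M) : specialFamily a b = specialFamily b a := by
  rw [specialFamily, specialFamily, pair_comm a b, pair_comm ({a}ᶜ : Set M)]

theorem finite_specialFamily : (specialFamily a b).Finite :=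
  toFinite {{a, b}, {a}ᶜ, {b}ᶜ}

theorem nonempty_of_mem_specialFamily (hab : a ≠ b) {X : Set M} (hX : X ∈ specialFamily a b) :
    X.Nonempty := by
  rcases hX with rfl | rfl | rfl
  exacts [insert_nonempty a {b}, ⟨b, hab.symm⟩, ⟨a, hab⟩]

theorem exists_ne_ne_of_two_lt_card (hM : 2 < Nat.card M) (a b : M) : ∃ c, c ≠ a ∧ c ≠ b := by
  by_contra! hall
  have huniv : ({a, b} : Set M) = univ := eq_univ_of_forall fun c =>
    or_iff_not_imp_left.2 (hall c)
  have hle := ncard_insert_le a {b}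
  rw [huniv, ncard_univ, ncard_singleton] at hle
  omega

theorem nontrivial_and_ne_univ_of_mem_specialFamily (hM : 2 < Nat.card M) (hab : a ≠ b)
    {X : Set M} (hX : X ∈ specialFamily a b) : X.Nontrivial ∧ X ≠ univ := by
  obtain ⟨c, hca, hcb⟩ := exists_ne_ne_of_two_lt_card hM a b
  rcases hX with rfl | rfl | rfl
  · exact ⟨nontrivial_pair hab, fun h => by simpa [hca, hcb] using h.ge (mem_univ c)⟩
  · exact ⟨⟨b, hab.symm, c, hca, hcb.symm⟩, fun h => h.ge (mem_univ a) rfl⟩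
  · exact ⟨⟨a, hab, c, hcb, hca.symm⟩, fun h => h.ge (mem_univ b) rfl⟩

theorem isAntichain_specialFamily (hM : 2 < Nat.card M) (hab : a ≠ b) :
    IsAntichain (· ⊆ ·) (specialFamily a b) := by
  obtain ⟨c, hca, hcb⟩ := exists_ne_ne_of_two_lt_card hM a b
  intro X hX Y hY hne hsub
  have ha := @hsub a
  have hb := @hsub b
  have hc := @hsub c
  rcases hX with rfl | rfl | rfl <;> rcases hY with rfl | rfl | rfl <;> simp_all [hab.symm]

theorem image_update_id [DecidableEq M] {X : Set M} (ha : a ∈ X) :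
    Function.update id a b '' X = insert b (X \ {a}) := by
  ext x
  simp only [mem_image, Function.update_apply, id, mem_insert_iff, mem_sdiff, mem_singleton_iff]
  grind

theorem exists_range_eq_pair {G : Set (Set M)} (hG : ∀ X ∈ G, X.Nonempty) (hpair : {a, b} ∈ G) :
    ∃ f : M → M, range f = {a, b} ∧ ∀ Y ∈ G, f '' Y ∈ ReducedPoset.carrier G := by
  classical
  let f : M → M := fun x => if x = a then a else b
  have hrange : range f = {a, b} := by
    apply Subset.antisymm
    · rintro _ ⟨x, rfl⟩
      exact ite_eq_or_eq (x = a) a b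
    · rintro _ (rfl | rfl)
      · exact ⟨_, if_pos rfl⟩
      · exact ⟨_, ite_eq_right_iff.2 Eq.symm⟩
  refine ⟨f, hrange, fun Y hY => ?_⟩
  have hsub : f '' Y ⊆ {a, b} := hrange ▸ image_subset_range f Y
  obtain h | h | h | h := subset_pair_iff_eq.1 hsub
  · exact absurd h ((hG Y hY).image f).ne_empty
  · exact h ▸ ReducedPoset.singleton_mem_carrier a
  · exact h ▸ ReducedPoset.singleton_mem_carrier b
  · exact h ▸ ReducedPoset.mem_carrier_of_mem hpair

theorem exists_range_eq_compl_left {G : Set (Set M)} (hab : a ≠ b) (hG : G ⊆ specialFamily a b)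
    (hcompl : {a}ᶜ ∈ G) :
    ∃ f : M → M, range f = {a}ᶜ ∧ ∀ Y ∈ G, f '' Y ∈ ReducedPoset.carrier G := by
  classical
  refine ⟨Function.update id a b, ?_, fun Y hY => ?_⟩
  · rw [← image_univ, image_update_id (mem_univ a)]
    grind
  · rcases hG hY with rfl | rfl | rfl
    · have hpair : Function.update id a b '' {a, b} = {b} := by
        rw [image_update_id (mem_insert a {b})]
        grind
      rw [hpair]
      exact ReducedPoset.singleton_mem_carrier b
    · have hfix : EqOn (Function.update id a b) id {a}ᶜ := fun x hx => Function.update_of_ne hx b id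
      rw [hfix.image_eq, image_id]
      exact ReducedPoset.mem_carrier_of_mem hcompl
    · have hswap : Function.update id a b '' {b}ᶜ = {a}ᶜ := by
        rw [image_update_id hab]
        grind
      rw [hswap]
      exact ReducedPoset.mem_carrier_of_mem hcompl

theorem exists_range_eq_of_mem_carrier {G : Set (Set M)} (hab : a ≠ b)
    (hG : G ⊆ specialFamily a b) {X : Set M} (hX : X ∈ ReducedPoset.carrier G) :
    ∃ f : M → M, range f = X ∧ ∀ Y ∈ G, f '' Y ∈ ReducedPoset.carrier G := by
  have hne : ∀ Y ∈ G, Y.Nonempty := fun Y hY => nonempty_of_mem_specialFamily hab (hG hY)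
  rcases hX with rfl | ⟨x, rfl⟩ | hX
  · exact ⟨id, range_id, fun Y hY => (image_id Y).symm ▸ ReducedPoset.mem_carrier_of_mem hY⟩
  · have : Nonempty M := ⟨x⟩
    exact ⟨fun _ => x, range_const, fun Y hY =>
      ((hne Y hY).image_const x).symm ▸ ReducedPoset.singleton_mem_carrier x⟩
  · rcases hG hX with rfl | rfl | rfl
    · exact exists_range_eq_pair hne hX
    · exact exists_range_eq_compl_left hab hG hX
    · exact exists_range_eq_compl_left hab.symm (specialFamily_comm a b ▸ hG) hX

theorem ppCovers_iff_exists_perm [Finite M] (hM : 2 < Nat.card M) (hab : a ≠ b)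
    {F G : Set (Set M)} (hF : F ⊆ specialFamily a b) (hG : G ⊆ specialFamily a b) :
    PPCovers (ReducedPoset F) (ReducedPoset G) ↔ ∃ τ : Equiv.Perm M, ∀ X ∈ F, τ '' X ∈ G := by
  have : Nonempty M := ⟨a⟩
  have hFne : ∀ X ∈ F, X.Nonempty := fun X hX => nonempty_of_mem_specialFamily hab (hF hX)
  have hGne : ∀ X ∈ G, X.Nonempty := fun X hX => nonempty_of_mem_specialFamily hab (hG hX)
  constructor
  · intro hcov
    obtain ⟨h, hh, hbot⟩ := hcov ⊥
    exact ReducedPoset.exists_perm_image_mem_of_bot_mem_range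
      (fun X hX => nontrivial_and_ne_univ_of_mem_specialFamily hM hab (hF hX)) hGne hh hbot
  · rintro ⟨τ, hτ⟩ q
    obtain ⟨f, hf, hfG⟩ := exists_range_eq_of_mem_carrier hab hG q.2
    have hrange : range (f ∘ τ) = q.1 := by rw [τ.surjective.range_comp, hf]
    obtain ⟨h, hh, hcoe⟩ := ReducedPoset.exists_isPPMorphism_coe_eq_image hFne hGne
      (f := f ∘ τ) (hrange ▸ q.2) fun X hX => image_comp f τ X ▸ hfG _ (hτ X hX)
    refine ⟨h, hh, ⊥, Subtype.ext ?_⟩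
    rw [hcoe, ReducedPoset.coe_bot, image_univ, hrange]

theorem exists_eq_compl_singleton_of_ncard_eq [Finite M] {X : Set M} {x : M}
    (hX : X.ncard = ({x}ᶜ : Set M).ncard) : ∃ y, X = {y}ᶜ := by
  have hXc : Xᶜ.ncard = 1 := by
    rw [ncard_compl, hX, ← ncard_compl, compl_compl, ncard_singleton]
  obtain ⟨y, hy⟩ := ncard_eq_one.1 hXc
  exact ⟨y, compl_eq_comm.1 hy |>.symm⟩

theorem exists_perm_image_eq (hM : 2 < Nat.card M) (hab : a ≠ b)
    (σ : Equiv.Perm (specialFamily a b))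
    (hσ : ∀ X : specialFamily a b, (σ X : Set M).ncard = (X : Set M).ncard) :
    ∃ τ : Equiv.Perm M, ∀ X : specialFamily a b, τ '' X.1 = σ X := by
  have : Finite M := Nat.finite_of_card_ne_zero (by omega)
  let A : specialFamily a b := ⟨{a}ᶜ, .inr (.inl rfl)⟩
  let B : specialFamily a b := ⟨{b}ᶜ, .inr (.inr rfl)⟩
  let D : specialFamily a b := ⟨{a, b}, .inl rfl⟩
  obtain ⟨a', ha'⟩ := exists_eq_compl_singleton_of_ncard_eq (hσ A)
  obtain ⟨b', hb'⟩ := exists_eq_compl_singleton_of_ncard_eq (hσ B)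
  have hab' : a' ≠ b' := by
    rintro rfl
    have hAB : A = B := σ.injective (Subtype.ext (ha'.trans hb'.symm))
    exact hab (singleton_injective (compl_injective (congrArg Subtype.val hAB)))
  -- `σ D ⊆ {x}ᶜ = σ X` is impossible, as the special family is an antichain.
  have hmem : ∀ X x, (σ X).1 = {x}ᶜ → X ≠ D → x ∈ (σ D).1 := fun X x hX hXD => by
    by_contra hx
    have hsub : (σ D).1 ⊆ (σ X).1 := hX ▸ subset_compl_singleton_iff.2 hx
    exact hXD (σ.injective (Subtype.ext
      ((isAntichain_specialFamily hM hab).eq (σ D).2 (σ X).2 hsub).symm))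
  have ha'D : a' ∈ (σ D).1 := hmem A a' ha' fun h =>
    (congrArg Subtype.val h).ge (mem_insert a {b}) rfl
  have hb'D : b' ∈ (σ D).1 := hmem B b' hb' fun h =>
    (congrArg Subtype.val h).ge (mem_insert_of_mem a rfl) rfl
  have hD : {a', b'} = (σ D).1 := by
    refine eq_of_subset_of_ncard_le (pair_subset ha'D hb'D) ?_
    rw [hσ D, ncard_pair hab, ncard_pair hab']
  obtain ⟨τ, hτa, hτb⟩ := (MulAction.is_two_pretransitive_iff (G := Equiv.Perm M)).1
    (Equiv.Perm.isMultiplyPretransitive M 2) hab hab'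
  rw [Equiv.Perm.smul_def] at hτa hτb
  refine ⟨τ, ?_⟩
  rintro ⟨X, rfl | rfl | rfl⟩
  · rw [image_pair, hτa, hτb, hD]
  · rw [image_compl_eq τ.bijective, image_singleton, hτa, ← ha']
  · rw [image_compl_eq τ.bijective, image_singleton, hτb, ← hb']

theorem exists_perm_image_mem_iff (hM : 2 < Nat.card M) (hab : a ≠ b) {F G : Set (Set M)}
    (hF : F ⊆ specialFamily a b) (hG : G ⊆ specialFamily a b) :
    (∃ τ : Equiv.Perm M, ∀ X ∈ F, τ '' X ∈ G) ↔
      ∃ σ : Equiv.Perm (specialFamily a b),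
        (∀ X : specialFamily a b, (σ X : Set M).ncard = (X : Set M).ncard) ∧
        ∀ X : specialFamily a b, (X : Set M) ∈ F → (σ X : Set M) ∈ G := by
  constructor
  · rintro ⟨τ, hτ⟩
    have := finite_specialFamily (a := a) (b := b).to_subtype
    let i : {X : specialFamily a b | X.1 ∈ F} → specialFamily a b := fun X =>
      ⟨τ '' X.1, hG (hτ _ X.2)⟩
    have hi : Function.Injective i := fun X Y hXY => Subtype.ext <| Subtype.ext <|
      τ.injective.image_injective (congrArg Subtype.val hXY)
    obtain ⟨σ, hcard, hσ⟩ := exists_perm_extend_of_injective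
      (fun X : specialFamily a b => X.1.ncard) hi
      fun X => ncard_image_of_injective X.1.1 τ.injective
    refine ⟨σ, hcard, fun X hX => ?_⟩
    rw [hσ ⟨X, hX⟩]
    exact hτ X hX
  · rintro ⟨σ, hcard, hσ⟩
    obtain ⟨τ, hτ⟩ := exists_perm_image_eq hM hab σ hcard
    exact ⟨τ, fun X hX => hτ ⟨X, hF hX⟩ ▸ hσ ⟨X, hF hX⟩ hX⟩

theorem not_isQuasivarietyCover_of_ssubset_specialFamily {m : ℕ} (hm : 2 ≤ m)
    (hM : m < Nat.card M) (hab : a ≠ b) {F : Set (Set M)} (hF : F ⊂ specialFamily a b) :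
    ¬ IsQuasivarietyCover (Pa m) (quasivarietyOf (dualAlg (ReducedPoset F))) := by
  have : Finite M := Nat.finite_of_card_ne_zero (by omega)
  have : Nonempty M := ⟨a⟩
  have hne : ∀ X ∈ specialFamily a b, X.Nonempty := fun X => nonempty_of_mem_specialFamily hab
  refine ReducedPoset.not_isQuasivarietyCover_of_ppCovers (G := specialFamily a b) (by omega) hM
    (fun X hX => hne X (hF.subset hX)) hne ?_ fun h hh hbot => ?_
  · exact (ppCovers_iff_exists_perm (hm.trans_lt hM) hab hF.subset subset_rfl).2
      ⟨1, fun X hX => by simpa using hF.subset hX⟩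
  · obtain ⟨τ, hτ⟩ := ReducedPoset.exists_perm_image_mem_of_bot_mem_range
      (fun X => nontrivial_and_ne_univ_of_mem_specialFamily (hm.trans_lt hM) hab)
      (fun X hX => hne X (hF.subset hX)) hh hbot
    have hlt := ncard_lt_ncard hF finite_specialFamily
    have hle := ncard_le_ncard_of_injOn (image τ) hτ τ.injective.image_injective.injOn
      (finite_specialFamily.subset hF.subset)
    omega

end SpecialFamily

theorem theorem3p4 {M : Type u} (m : ℕ) (hm : 2 ≤ m) (hM : Nat.card M = m + 1)
    (a b : M) (hab : a ≠ b) :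
    (∀ F : Set (Set M), F ⊂ specialFamily a b →
      ¬ IsQuasivarietyCover (Pa m) (quasivarietyOf (dualAlg (ReducedPoset F)))) ∧
    (∀ F G : Set (Set M), F ⊆ specialFamily a b → G ⊆ specialFamily a b →
      ((∃ (n : ℕ) (h : (Σ _ : Fin n, ReducedPoset F) → ReducedPoset G),
          IsPPMorphism h ∧ Function.Surjective h) ↔
        ∃ σ : Equiv.Perm (specialFamily a b),
          (∀ X : specialFamily a b, (σ X : Set M).ncard = (X : Set M).ncard) ∧
          ∀ X : specialFamily a b, (X : Set M) ∈ F → (σ X : Set M) ∈ G)) := by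
  have : Finite M := Nat.finite_of_card_ne_zero (by omega)
  have hM2 : 2 < Nat.card M := by omega
  refine ⟨fun F hF => not_isQuasivarietyCover_of_ssubset_specialFamily hm (by omega) hab hF,
    fun F G hF hG => ?_⟩
  rw [exists_surjective_copies_iff_ppCovers, ppCovers_iff_exists_perm hM2 hab hF hG,
    exists_perm_image_mem_iff hM2 hab hF hG]
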